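/- An $\ell$-group is a (not necessarily commutative, additively written) group $G$ with a lattice order that is invariant under left and right translations; $\mathrm C(G)$ denotes its centre. Let $(G,u)$ be a unital $\ell$-group, i.e. $u\ge 0$ is a strong unit: for each $g\in G$ there is an integer $n\ge1$ with $g\le nu$. Let $M=\Gamma(G,u)$ be the pseudo MV-algebra on $[0,u]=\{x\in G: 0\le x\le u\}$ with zero $0$, unit $1=u$ and $$x\oplus y=(x+y)\wedge u,\quad x^-=u-x,\quad x^\sim=-x+u,\quad x\odot y=(x-u+y)\vee 0 .$$ $M$ is symmetric if $x^-=x^\sim$ for all $x\in M$; it is two-divisible if for each $x\in M$ there is $y\in M$ with $y\le y^-$ and $y\oplus y=x$ (equivalently, $y+y=x$ in $G$); it is representable if it is a subdirect product of linearly ordered pseudo MV-algebras. A weak square root on $M$ is a map $r:M\to M$ such that, for all $x,y\in M$, $r(x)\odot r(x)=x$, and $y\odot y\le x$ implies $y\le r(x)$. It is a square root if moreover $r(x^-)=r(x)^-\oplus r(0)$ and $r(x^\sim)=r(0)\oplus r(x)^\sim$ for all $x\in M$. A (weak) square root $r$ is strict if $r(0)=r(0)^-$. **Corollary.** Let $M=\Gamma(G,u)$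 be representable. Then for each $g\in G$ there is at most one $h\in G$ with $h+h=g$; it is denoted by $g/2$ if it exists. Moreover: 1. $M$ has a strict square root if and only if $M$ is two-divisible and $u/2$ exists and lies in $\mathrm C(G)$. In this case $M$ is symmetric, and every strict square root $r$ on $M$ satisfies $r(M)=[u/2,u]$. 2. $M$ has a strict weak square root if and only if $M$ is two-divisible. In this case $u/2$ exists, and every strict weak square root $r$ on $M$ satisfies $r(M)=[u/2,u]$. 3. (a) If $r$ is a strict square root on $M$, then for each $x\in M$ the element $(x+u)/2$ exists and $r(x)=(x+u)/2$. (b) If $r$ is any square root on $M$ and $w=r(0)^-\odot r(0)^-$, then for each $x\in M$ the element $((x\wedge w^-)+w^-)/2$ exists in $G$ and $r(x)=(x\wedge w)\vee\big((x\wedge w^-)+w^-\big)/2$. (Symmetry of $M$ is not assumed in either case.) 4. If $M$ is two-divisible and $u/2\in \mathrm C(G)$, then every strict weak square root on $M$ is a square root. -/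

import Mathlib

namespace PMV

/-- The operations of a pseudo MV-algebra: `oplus x y` is `x ⊕ y`, `lneg x` is `x⁻`,
`rneg x` is `x∼`, together with the constants `0` and `1`. -/
class PseudoMVSignature (M : Type*) where
  oplus : M → M → M
  lneg : M → M
  rneg : M → M
  zero : M
  one : M

open PseudoMVSignature

/-- `x ⊙ y = (y⁻ ⊕ x⁻)∼`. -/
def odot {M : Type*} [PseudoMVSignature M] (x y : M) : M :=
  rneg (oplus (lneg y) (lneg x))

infixl:65 " ⊕ₘ " => PseudoMVSignature.oplus
infixl:70 " ⊙ₘ " => PMV.odot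

/-- Pseudo MV-algebras. -/
class PseudoMVAlgebra (M : Type*) extends PseudoMVSignature M where
  oplus_assoc : ∀ x y z : M, x ⊕ₘ (y ⊕ₘ z) = (x ⊕ₘ y) ⊕ₘ z
  oplus_zero : ∀ x : M, x ⊕ₘ zero = x
  zero_oplus : ∀ x : M, zero ⊕ₘ x = x
  oplus_one : ∀ x : M, x ⊕ₘ one = one
  one_oplus : ∀ x : M, one ⊕ₘ x = one
  lneg_one : lneg one = zero
  rneg_one : rneg one = zero
  rneg_lneg_oplus : ∀ x y : M, rneg (lneg x ⊕ₘ lneg y) = lneg (rneg x ⊕ₘ rneg y)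
  sup_eq₁ : ∀ x y : M, x ⊕ₘ (rneg x ⊙ₘ y) = y ⊕ₘ (rneg y ⊙ₘ x)
  sup_eq₂ : ∀ x y : M, y ⊕ₘ (rneg y ⊙ₘ x) = (x ⊙ₘ lneg y) ⊕ₘ y
  sup_eq₃ : ∀ x y : M, (x ⊙ₘ lneg y) ⊕ₘ y = (y ⊙ₘ lneg x) ⊕ₘ x
  inf_eq : ∀ x y : M, x ⊙ₘ (lneg x ⊕ₘ y) = (x ⊕ₘ rneg y) ⊙ₘ y
  rneg_lneg : ∀ x : M, rneg (lneg x) = x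

section Basic

variable {M : Type*} [PseudoMVAlgebra M]

/-- The order of a pseudo MV-algebra: `x ≤ y` iff `x ∨ y = y`, where `x ∨ y = x ⊕ (x∼ ⊙ y)`. -/
def le (x y : M) : Prop := x ⊕ₘ (rneg x ⊙ₘ y) = y

/-- The partial addition: `x + y` is defined iff `x ≤ y⁻`, and then `x + y = x ⊕ y`.
`IsPartialSum x y z` says that `x + y` is defined and equals `z`. -/
def IsPartialSum (x y z : M) : Prop := le x (lneg y) ∧ x ⊕ₘ y = z

/-- `x → y = x⁻ ⊕ y`. -/
def limp (x y : M) : M := lneg x ⊕ₘ y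

/-- `x ⇝ y = y ⊕ x∼`. -/
def rimp (x y : M) : M := y ⊕ₘ rneg x

variable (M) in
/-- `M` is symmetric: `x⁻ = x∼` for all `x`. -/
def IsSymmetric : Prop := ∀ x : M, rneg x = lneg x

variable (M) in
/-- `M` is two-divisible: each `x` is `y + y` (partial addition) for some `y`. -/
def IsTwoDivisible : Prop := ∀ x : M, ∃ y : M, IsPartialSum y y x

variable (M) in
/-- `M` is linearly ordered. -/
def IsLinear : Prop := ∀ x y : M, le x y ∨ le y x

/-- A weak square root on `M`. -/
structure IsWeakSquareRoot (r : M → M) : Prop where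
  odot_self : ∀ x : M, r x ⊙ₘ r x = x
  le_of_odot_le : ∀ x y : M, le (y ⊙ₘ y) x → le y (r x)

/-- A square root on `M`. -/
structure IsSquareRoot (r : M → M) : Prop extends IsWeakSquareRoot r where
  map_lneg : ∀ x : M, r (lneg x) = limp (r x) (r zero)
  map_rneg : ∀ x : M, r (rneg x) = rimp (r x) (r zero)

/-- A (weak) square root `r` is strict if `r(0) = r(0)⁻`. -/
def IsStrict (r : M → M) : Prop := r zero = lneg (r zero)

/-- Homomorphisms of pseudo MV-algebras. -/
structure IsHom {N : Type*} [PseudoMVAlgebra N] (f : M → N) : Prop where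
  map_oplus : ∀ x y : M, f (x ⊕ₘ y) = f x ⊕ₘ f y
  map_lneg : ∀ x : M, f (lneg x) = lneg (f x)
  map_rneg : ∀ x : M, f (rneg x) = rneg (f x)
  map_zero : f zero = zero
  map_one : f one = one

end Basic

/-- `M` is representable: it is a subdirect product of linearly ordered pseudo MV-algebras, i.e.
there is an injective homomorphism `x ↦ (f i x)ᵢ` of `M` into a product `∏ᵢ A i` of linearly
ordered pseudo MV-algebras all of whose components `f i : M → A i` are surjective.
(The `A i` are quotients of `M`, so the universe of `M` suffices.) -/
def IsRepresentable.{v} (M : Type v) [PseudoMVAlgebra M] : Prop :=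
  ∃ (ι : Type v) (A : ι → Type v) (_ : ∀ i, PseudoMVAlgebra (A i)) (f : ∀ i, M → A i),
    (∀ i, IsLinear (A i)) ∧
    (∀ i, IsHom (f i)) ∧
    (∀ i, Function.Surjective (f i)) ∧
    Function.Injective (fun (x : M) (i : ι) => f i x)

/-- A strong unit of the (not necessarily commutative, additively written) lattice-ordered
group `G`. -/
structure StrongUnit (G : Type*) [AddGroup G] [Lattice G] where
  val : G
  nonneg : 0 ≤ val
  exists_le_nsmul : ∀ g : G, ∃ n : ℕ, 1 ≤ n ∧ g ≤ n • val

/-- `IsHalf g h` says that `h` is a half of `g` in the group `G`, i.e. `h + h = g`. -/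
def IsHalf {G : Type*} [AddGroup G] (g h : G) : Prop := h + h = g

section Gamma

variable {G : Type*} [AddGroup G] [Lattice G] [AddLeftMono G] [AddRightMono G]

/-- The underlying set `[0, u]` of `Γ(G, u)`. -/
abbrev Gamma (u : StrongUnit G) : Type _ := Set.Icc (0 : G) u.val

instance Gamma.signature (u : StrongUnit G) : PseudoMVSignature (Gamma u) where
  oplus x y := ⟨((x : G) + y) ⊓ u.val, le_inf (add_nonneg x.2.1 y.2.1) u.nonneg, inf_le_right⟩
  lneg x := ⟨u.val - x, sub_nonneg.2 x.2.2, sub_le_self _ x.2.1⟩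
  rneg x := ⟨-(x : G) + u.val, by simpa using x.2.2, by simpa using x.2.1⟩
  zero := ⟨0, le_rfl, u.nonneg⟩
  one := ⟨u.val, u.nonneg, le_rfl⟩

variable {u : StrongUnit G}

theorem Gamma.coe_oplus (x y : Gamma u) : ((x ⊕ₘ y : Gamma u) : G) = ((x : G) + y) ⊓ u.val := rfl

theorem Gamma.coe_lneg (x : Gamma u) : ((lneg x : Gamma u) : G) = u.val - x := rfl

theorem Gamma.coe_rneg (x : Gamma u) : ((rneg x : Gamma u) : G) = -x + u.val := rfl

theorem Gamma.coe_zero : ((zero : Gamma u) : G) = 0 := rfl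

theorem Gamma.coe_one : ((one : Gamma u) : G) = u.val := rfl

theorem Gamma.coe_odot (x y : Gamma u) :
    ((x ⊙ₘ y : Gamma u) : G) = ((x : G) - u.val + y) ⊔ 0 := by
  simp only [odot, Gamma.coe_rneg, Gamma.coe_oplus, Gamma.coe_lneg, neg_inf, sup_add]
  congr 1 <;> simp [sub_eq_add_neg, add_assoc]

theorem Gamma.coe_sup (x y : Gamma u) :
    ((x ⊕ₘ (rneg x ⊙ₘ y) : Gamma u) : G) = (x : G) ⊔ y := by
  rw [Gamma.coe_oplus, Gamma.coe_odot, Gamma.coe_rneg, add_sup]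
  simp only [add_sub_cancel_right, add_neg_cancel_left, add_zero]
  rw [sup_comm, inf_eq_left]
  exact sup_le x.2.2 y.2.2

theorem Gamma.coe_sup' (x y : Gamma u) :
    (((x ⊙ₘ lneg y) ⊕ₘ y : Gamma u) : G) = (x : G) ⊔ y := by
  rw [Gamma.coe_oplus, Gamma.coe_odot, Gamma.coe_lneg, sup_add]
  simp only [sub_add_sub_cancel, sub_add_cancel, zero_add]
  rw [inf_eq_left]
  exact sup_le x.2.2 y.2.2

/-- The pseudo MV-algebra `Γ(G, u)`. -/
instance Gamma.pseudoMVAlgebra (u : StrongUnit G) : PseudoMVAlgebra (Gamma u) where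
  toPseudoMVSignature := Gamma.signature u
  oplus_assoc x y z := by
    ext
    simp only [Gamma.coe_oplus, add_inf, inf_add, inf_assoc, add_assoc]
    rw [inf_eq_right.2 (le_add_of_nonneg_left x.2.1), inf_eq_right.2 (le_add_of_nonneg_right z.2.1)]
  oplus_zero x := by
    ext
    simpa [Gamma.coe_oplus, Gamma.coe_zero] using x.2.2
  zero_oplus x := by
    ext
    simpa [Gamma.coe_oplus, Gamma.coe_zero] using x.2.2
  oplus_one x := by
    ext
    simpa [Gamma.coe_oplus, Gamma.coe_one] using x.2.1
  one_oplus x := by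
    ext
    simpa [Gamma.coe_oplus, Gamma.coe_one] using x.2.1
  lneg_one := by
    ext
    simp [Gamma.coe_lneg, Gamma.coe_one, Gamma.coe_zero]
  rneg_one := by
    ext
    simp [Gamma.coe_rneg, Gamma.coe_one, Gamma.coe_zero]
  rneg_lneg_oplus x y := by
    ext
    simp only [Gamma.coe_rneg, Gamma.coe_lneg, Gamma.coe_oplus, sub_eq_add_neg, neg_inf, sup_add,
      add_sup]
    congr 1 <;> simp [add_assoc]
  sup_eq₁ x y := by
    ext
    rw [Gamma.coe_sup, Gamma.coe_sup, sup_comm]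
  sup_eq₂ x y := by
    ext
    rw [Gamma.coe_sup, Gamma.coe_sup', sup_comm]
  sup_eq₃ x y := by
    ext
    rw [Gamma.coe_sup', Gamma.coe_sup', sup_comm]
  inf_eq x y := by
    ext
    simp only [Gamma.coe_odot, Gamma.coe_oplus, Gamma.coe_lneg, Gamma.coe_rneg, sub_eq_add_neg,
      add_inf, inf_add]
    congr 1
    simp [add_assoc, inf_comm]
  rneg_lneg x := by
    ext
    simp [Gamma.coe_lneg, Gamma.coe_rneg]

/-- The order of `Γ(G, u)` is the restriction of the order of `G`. -/
theorem Gamma.le_iff (x y : Gamma u) : le x y ↔ (x : G) ≤ y := by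
  rw [le, ← sup_eq_right, ← Gamma.coe_sup, Subtype.ext_iff]

end Gamma

end PMV

/-! Representability is passed from `Gamma u` to `G`. For a homomorphism `f` of `Gamma u` to a
chain, the elements `g` whose truncation to `[0, u]` is killed by `f` form a total
conjugation-invariant cone, and the quotient of `G` by the elements lying in the cone together with
their negatives is a linearly ordered group. Since `u` is a strong unit, these quotients determine
the order of `G` (`IsRepresentable.le_of_forall_hom`), so doubling reflects the order and halves are
unique.

In the strict case `c = r 0` satisfies `c + c = u` and `c ≤ r x`, so the truncation in `r x ⊙ r x =
x` is idle and `r x - u` is the half of `x - u`. Strict weak square roots thus amount to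
two-divisibility. The extra axioms of a square root force `c` to commute with every `r x`, hence
with `[0, u]`, hence with `G`; conversely, a central `c` yields these axioms by uniqueness of
halves.

For an arbitrary square root, each linearly ordered image is of one of two kinds
(`square_root_linearOrder`): either `r 0` maps to `0` and `r x` has the image of `x`, or `r 0` maps
to a half of `u` and `r x` to a half of `x + u`. The element `w` maps to `u` in the first kind and
to `0` in the second, so the formula for `r x` can be checked image by image. -/

namespace PMV

open PseudoMVSignature

/-! ### Linearly ordered quotients of `G` from representability of `Gamma u` -/

section Chains

universe v

/-- A total conjugation-invariant cone `Q` (of the elements that are to become nonpositive)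
of an `ℓ`-group `G` comes from a homomorphism onto a linearly ordered group. -/
theorem exists_hom_linearOrder {G : Type v} [AddGroup G] [Lattice G] [AddRightMono G]
    (Q : G → Prop)
    (hadd : ∀ a b, Q a → Q b → Q (a + b)) (hconj : ∀ m g, Q g → Q (m + g - m))
    (htotal : ∀ g, Q g ∨ Q (-g)) (hsup : ∀ g, Q g → Q (g ⊔ 0)) (hnonpos : ∀ g, g ≤ 0 → Q g) :
    ∃ (H : Type v) (_ : AddGroup H) (_ : LinearOrder H) (_ : AddLeftMono H) (_ : AddRightMono H)
      (φ : G →+ H), (∀ a b, φ (a ⊔ b) = φ a ⊔ φ b) ∧ ∀ g, φ g ≤ 0 ↔ Q g := by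
  classical
  have h0 : Q 0 := hnonpos 0 le_rfl
  let N : AddSubgroup G :=
    { carrier := {g | Q g ∧ Q (-g)}
      zero_mem' := ⟨h0, by simpa using h0⟩
      add_mem' := fun {a b} ha hb => ⟨hadd _ _ ha.1 hb.1, by
        rw [neg_add_rev]; exact hadd _ _ hb.2 ha.2⟩
      neg_mem' := fun {a} ha => ⟨ha.2, by simpa using ha.1⟩ }
  have hN : N.Normal := ⟨fun n hn g => by
    refine ⟨?_, ?_⟩
    · simpa [sub_eq_add_neg, add_assoc] using hconj g n hn.1
    · simpa [sub_eq_add_neg, add_assoc] using hconj g (-n) hn.2⟩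
  let φ : G →+ G ⧸ N := QuotientAddGroup.mk' N
  let R : G ⧸ N → Prop := fun A => ∃ g, Q g ∧ φ g = A
  have hφ : Function.Surjective φ := QuotientAddGroup.mk'_surjective N
  have hR : ∀ g, R (φ g) ↔ Q g := fun g => by
    refine ⟨fun ⟨a, ha, hag⟩ => ?_, fun h => ⟨g, h, rfl⟩⟩
    have : -a + g ∈ N := QuotientAddGroup.eq.1 hag
    simpa using hadd _ _ ha this.1
  have hRadd : ∀ A B, R A → R B → R (A + B) := by
    rintro _ _ ⟨a, ha, rfl⟩ ⟨b, hb, rfl⟩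
    exact ⟨a + b, hadd _ _ ha hb, map_add _ _ _⟩
  have hRconj : ∀ C A, R A → R (C + A - C) := by
    rintro C _ ⟨a, ha, rfl⟩
    obtain ⟨m, rfl⟩ := hφ C
    exact ⟨m + a - m, hconj _ _ ha, by simp⟩
  have hRanti : ∀ A, R A → R (-A) → A = 0 := by
    intro A h1 h2
    obtain ⟨a, rfl⟩ := hφ A
    rw [← map_neg, hR] at h2
    rw [hR] at h1
    exact (QuotientAddGroup.eq_zero_iff a).2 ⟨h1, h2⟩
  have hRtotal : ∀ A, R A ∨ R (-A) := by
    intro A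
    obtain ⟨a, rfl⟩ := hφ A
    rw [← map_neg, hR, hR]
    exact htotal a
  let ord : LinearOrder (G ⧸ N) :=
    { le := fun A B => R (A - B)
      le_refl := fun A => ⟨0, h0, by simp⟩
      le_trans := fun A B C h1 h2 => by simpa using hRadd _ _ h1 h2
      le_antisymm := fun A B h1 h2 => sub_eq_zero.1 (hRanti _ h1 (by simpa using h2))
      le_total := fun A B => by simpa using hRtotal (A - B)
      toDecidableLE := Classical.decRel _ }
  have hle : ∀ A B : G ⧸ N, ord.le A B ↔ R (A - B) := fun A B => Iff.rfl
  -- The order compares through `A - B`, which right translation leaves unchanged; left translation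
  -- conjugates it, hence `hconj`.
  have hl : AddLeftMono (G ⧸ N) := ⟨fun C A B h => by
    have := hRconj C _ h
    change R _
    simpa [sub_eq_add_neg, add_assoc] using this⟩
  have hr : AddRightMono (G ⧸ N) := ⟨fun C A B h => by
    change R (A + C - (B + C))
    rw [add_sub_add_right_eq_sub]
    exact h⟩
  refine ⟨G ⧸ N, inferInstance, ord, hl, hr, φ, fun a b => ?_, fun g => ?_⟩
  · have key : ∀ a b : G, R (φ a - φ b) → φ (a ⊔ b) ≤ φ b := fun a b h => by
      rw [← map_sub, hR] at h
      change R _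
      rw [← map_sub, hR, sub_eq_add_neg, sup_add]
      simpa [sub_eq_add_neg] using hsup _ h
    have mono : ∀ a b : G, a ≤ b → φ a ≤ φ b := fun a b h => by
      change R _
      rw [← map_sub, hR]
      exact hnonpos _ (sub_nonpos.2 h)
    apply le_antisymm
    · rcases le_total (φ a) (φ b) with h | h
      · exact (key a b h).trans le_sup_right
      · rw [sup_comm a b]
        exact (key b a h).trans le_sup_left
    · exact sup_le (mono _ _ le_sup_left) (mono _ _ le_sup_right)
  · rw [← hR, hle, sub_zero]

/-- Truncation of an element of `G` to `[0, u]`. -/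
def trunc {G : Type*} [AddGroup G] [Lattice G] (u : StrongUnit G) (g : G) : Gamma u :=
  ⟨(g ⊔ 0) ⊓ u.val, le_inf le_sup_right u.nonneg, inf_le_right⟩

theorem coe_trunc {G : Type*} [AddGroup G] [Lattice G] {u : StrongUnit G} (g : G) :
    (trunc u g : G) = (g ⊔ 0) ⊓ u.val := rfl

variable {G : Type v} [AddGroup G] [Lattice G] [AddLeftMono G] [AddRightMono G]

theorem add_inf_le_inf_add_inf {a s t : G} (ha : 0 ≤ a) (hs : 0 ≤ s) (ht : 0 ≤ t) :
    (s + t) ⊓ a ≤ s ⊓ a + t ⊓ a := by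
  rw [inf_add, add_inf, add_inf]
  refine le_inf (le_inf inf_le_left ?_) (le_inf ?_ ?_) <;> refine inf_le_right.trans ?_
  · exact le_add_of_nonneg_left hs
  · exact le_add_of_nonneg_right ht
  · exact le_add_of_nonneg_left ha

/-- Subadditivity of `· ⊓ a` on positive elements spreads disjointness from `u` to all multiples of
`u`, one of which dominates `a`. -/
theorem StrongUnit.eq_zero_of_inf_eq_zero (u : StrongUnit G) {a : G} (ha : 0 ≤ a)
    (h : a ⊓ u.val = 0) : a = 0 := by
  have hn : ∀ n : ℕ, (n • u.val) ⊓ a ≤ 0 := fun n => by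
    induction n with
    | zero => simp
    | succ n ih =>
      rw [succ_nsmul]
      refine (add_inf_le_inf_add_inf ha (nsmul_nonneg u.nonneg n) u.nonneg).trans ?_
      rw [inf_comm u.val, h, add_zero]
      exact ih
  obtain ⟨n, -, hau⟩ := u.exists_le_nsmul a
  exact le_antisymm (by simpa [inf_eq_right.2 hau] using hn n) ha

/-- A set closed under addition which contains `[0, u]` and `-u` is everything. -/
theorem StrongUnit.induction (u : StrongUnit G) {p : G → Prop}
    (hIcc : ∀ m, 0 ≤ m → m ≤ u.val → p m) (hneg : p (-u.val))
    (hadd : ∀ a b, p a → p b → p (a + b)) (g : G) : p g := by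
  have hpos : ∀ (n : ℕ) (g : G), 0 ≤ g → g ≤ n • u.val → p g := fun n => by
    induction n with
    | zero =>
      intro g h1 h2
      exact hIcc g h1 ((by simpa using h2 : g ≤ 0).trans u.nonneg)
    | succ n ih =>
      intro g h1 h2
      -- Splitting off `g ⊓ u` lowers the bound on the remainder by one copy of `u`.
      have e : g = g ⊓ u.val + (-(g ⊓ u.val) + g) := by simp
      rw [e]
      refine hadd _ _ (hIcc _ (le_inf h1 u.nonneg) inf_le_right) (ih _ ?_ ?_)
      · rw [le_neg_add_iff_add_le, add_zero]
        exact inf_le_left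
      · rw [neg_inf, sup_add, neg_add_cancel]
        refine sup_le (nsmul_nonneg u.nonneg n) ?_
        rw [neg_add_le_iff_le_add]
        rwa [succ_nsmul'] at h2
  have hnn : ∀ n : ℕ, p (-(n • u.val)) := fun n => by
    induction n with
    | zero => simpa using hIcc 0 le_rfl u.nonneg
    | succ n ih =>
      rw [succ_nsmul, neg_add_rev]
      exact hadd _ _ hneg ih
  obtain ⟨n, -, hn⟩ := u.exists_le_nsmul (-g)
  have h0 : 0 ≤ n • u.val + g := by
    rw [← neg_add_cancel g]
    gcongr
  obtain ⟨k, -, hk⟩ := u.exists_le_nsmul (n • u.val + g)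
  simpa using hadd _ _ (hnn n) (hpos k _ h0 hk)

variable {u : StrongUnit G}

section Hom

variable {A : Type*} [PseudoMVAlgebra A] {f : Gamma u → A}

theorem IsHom.map_odot (hf : IsHom f) (x y : Gamma u) : f (x ⊙ₘ y) = f x ⊙ₘ f y := by
  simp only [odot, hf.map_rneg, hf.map_oplus, hf.map_lneg]

/-- For `x ≤ y` the meet is `x = (x ⊕ y∼) ⊙ y`, and a product with a factor killed by `f` is killed.
-/
theorem IsHom.eq_zero_of_le (hf : IsHom f) {x y : Gamma u} (hxy : (x : G) ≤ y)
    (hy : f y = f zero) : f x = f zero := by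
  have e : x = (x ⊕ₘ rneg y) ⊙ₘ y := by
    ext
    rw [← PseudoMVAlgebra.inf_eq, Gamma.coe_odot, Gamma.coe_oplus, Gamma.coe_lneg, add_inf]
    simp only [sub_eq_add_neg, add_assoc, neg_add_cancel, add_zero, neg_add_cancel_left,
      add_neg_cancel_left]
    rw [inf_eq_right.2 hxy, sup_eq_left.2 x.2.1]
  have e0 : (x ⊕ₘ rneg y) ⊙ₘ (zero : Gamma u) = zero := by
    ext
    rw [Gamma.coe_odot, Gamma.coe_zero, add_zero, sup_eq_right]
    exact sub_nonpos.2 (x ⊕ₘ rneg y).2.2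
  rw [e, hf.map_odot, hy, ← hf.map_odot, e0]

theorem IsHom.eq_zero_of_le_add (hf : IsHom f) {x y z : Gamma u} (h : (x : G) ≤ y + z)
    (hy : f y = f zero) (hz : f z = f zero) : f x = f zero := by
  refine hf.eq_zero_of_le (y := y ⊕ₘ z) (le_inf h x.2.2) ?_
  rw [hf.map_oplus, hy, hz, ← hf.map_oplus, PseudoMVAlgebra.oplus_zero]

/-- Disjointness gives `x⁻ ∨ y⁻ = 1`; in a chain the join is one of its two terms. Applied to the
positive and negative parts of `g`, this makes the cone total. -/
theorem IsHom.eq_zero_or_eq_zero (hf : IsHom f) (hA : IsLinear A) {x y : Gamma u}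
    (h : (x : G) ⊓ y = 0) : f x = f zero ∨ f y = f zero := by
  have hs : lneg x ⊕ₘ (rneg (lneg x) ⊙ₘ lneg y) = (one : Gamma u) := by
    ext
    rw [Gamma.coe_sup, Gamma.coe_lneg, Gamma.coe_lneg, Gamma.coe_one, sub_eq_add_neg,
      sub_eq_add_neg, ← add_sup, ← neg_inf, h, neg_zero, add_zero]
  have hs' : lneg y ⊕ₘ (rneg (lneg y) ⊙ₘ lneg x) = (one : Gamma u) := by
    rw [PseudoMVAlgebra.sup_eq₁, hs]
  have key : ∀ z : Gamma u, f (lneg z) = f one → f z = f zero := fun z hz => by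
    rw [← PseudoMVAlgebra.rneg_lneg z, hf.map_rneg, hz, ← hf.map_rneg, PseudoMVAlgebra.rneg_one]
  rcases hA (f (lneg x)) (f (lneg y)) with h1 | h1
  · right
    rw [le, ← hf.map_rneg, ← hf.map_odot, ← hf.map_oplus, hs] at h1
    exact key y h1.symm
  · left
    rw [le, ← hf.map_rneg, ← hf.map_odot, ← hf.map_oplus, hs'] at h1
    exact key x h1.symm

/-- If `f` kills the truncation of `g`, then it kills that of every conjugate of `g`. -/
theorem IsHom.trunc_conj (hf : IsHom f) (m g : G) (hg : f (trunc u g) = f zero) :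
    f (trunc u (m + g - m)) = f zero := by
  induction m using u.induction generalizing g with
  | hadd a b iha ihb =>
    have := iha _ (ihb _ hg)
    simpa [sub_eq_add_neg, add_assoc] using this
  | hneg =>
    -- Conjugation by `-u` is the operation `x ↦ x∼∼` of the algebra.
    have e : trunc u (-u.val + g - -u.val) = rneg (rneg (trunc u g)) := by
      ext
      have : (-u.val + g - -u.val) ⊔ 0 = -u.val + (g ⊔ 0) + u.val := by
        rw [add_sup, sup_add]; simp
      rw [Gamma.coe_rneg, Gamma.coe_rneg, coe_trunc, coe_trunc, this]
      simp only [neg_add_rev, neg_neg]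
      rw [add_inf, inf_add]; simp
    have e0 : rneg (rneg (zero : Gamma u)) = zero := by
      ext; simp [Gamma.coe_rneg, Gamma.coe_zero]
    rw [e, hf.map_rneg, hf.map_rneg, hg, ← hf.map_rneg, ← hf.map_rneg, e0]
  | hIcc m h0 hu =>
    obtain ⟨n, rfl⟩ : ∃ n : Gamma u, (n : G) = m := ⟨⟨m, h0, hu⟩, rfl⟩
    set b := trunc u g with hb
    let b' : Gamma u := ⟨(b : G) ⊓ n, le_inf b.2.1 n.2.1, inf_le_left.trans b.2.2⟩
    have hb' : f b' = f zero := hf.eq_zero_of_le inf_le_left hg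
    have hs : (n + g - n : G) ⊔ 0 = n + (g ⊔ 0) - n := by
      rw [add_sup, sub_eq_add_neg, sub_eq_add_neg, sup_add]; simp
    have h0' : (0 : G) ≤ n + (g ⊔ 0) - n := by rw [← hs]; exact le_sup_right
    have hn0 : n ⊙ₘ lneg n = zero := by
      ext; simp [Gamma.coe_odot, Gamma.coe_lneg, Gamma.coe_zero]
    -- As `u = (u - n) + n`, the truncated conjugate lies below the sum of the meets of `n + (g ⊔ 0)
    -- - n` with `u - n` and with `n`. Both meets are terms in `n`, `b`, `b'` that vanish when `b`
    -- and `b'` are replaced by `0`.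
    refine hf.eq_zero_of_le_add (y := (n ⊕ₘ b) ⊙ₘ lneg n) (z := n ⊙ₘ lneg (n ⊙ₘ lneg b')) ?_ ?_ ?_
    · have e1 : ((n ⊙ₘ lneg (n ⊙ₘ lneg b') : Gamma u) : G) = (n + (g ⊔ 0) - n) ⊓ n := by
        have : ((n ⊙ₘ lneg b' : Gamma u) : G) = n - b' := by
          rw [Gamma.coe_odot, Gamma.coe_lneg]
          simp only [sub_add_sub_cancel, sup_eq_left, sub_nonneg]
          exact inf_le_right
        rw [Gamma.coe_odot, Gamma.coe_lneg, this, sub_add_sub_cancel, sub_sub_eq_add_sub]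
        rw [sup_eq_left.2]
        · change (n + ((g ⊔ 0) ⊓ u.val ⊓ n) - n : G) = _
          rw [inf_assoc, inf_eq_right.2 n.2.2, add_inf, sub_eq_add_neg, inf_add,
            ← sub_eq_add_neg, ← sub_eq_add_neg, add_sub_cancel_right]
        · rw [← sub_sub_eq_add_sub, sub_nonneg]
          exact sub_le_self _ b'.2.1
      have e2 : (((n ⊕ₘ b) ⊙ₘ lneg n : Gamma u) : G) = (n + (g ⊔ 0) - n) ⊓ (u.val - n) := by
        rw [Gamma.coe_odot, Gamma.coe_lneg, sub_add_sub_cancel, Gamma.coe_oplus, hb, coe_trunc,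
          add_inf, inf_assoc, inf_eq_right.2 (le_add_of_nonneg_left n.2.1), sub_eq_add_neg,
          inf_add, ← sub_eq_add_neg, ← sub_eq_add_neg, sup_eq_left]
        exact le_inf h0' (sub_nonneg.2 n.2.2)
      rw [e1, e2, coe_trunc, hs, inf_comm _ u.val, inf_comm, inf_comm _ (n : G),
        inf_comm _ (u.val - n : G)]
      have := add_inf_le_inf_add_inf h0' (sub_nonneg.2 n.2.2) n.2.1
      rwa [sub_add_cancel, inf_comm u.val] at this
    · rw [hf.map_odot, hf.map_oplus, hg, ← hf.map_oplus, PseudoMVAlgebra.oplus_zero, ← hf.map_odot,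
        hn0]
    · rw [hf.map_odot, hf.map_lneg, hf.map_odot, hf.map_lneg, hb', ← hf.map_lneg, ← hf.map_odot,
        ← hf.map_lneg, ← hf.map_odot]
      congr 1
      ext
      simp [Gamma.coe_odot, Gamma.coe_lneg, Gamma.coe_zero, n.2.1]

/-- A homomorphism of `Γ(G, u)` onto a linearly ordered pseudo MV-algebra yields a homomorphism of
`G` into a linearly ordered group. -/
theorem IsHom.exists_hom_linearOrder (hf : IsHom f) (hA : IsLinear A) :
    ∃ (H : Type v) (_ : AddGroup H) (_ : LinearOrder H) (_ : AddLeftMono H) (_ : AddRightMono H)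
      (φ : G →+ H), (∀ a b, φ (a ⊔ b) = φ a ⊔ φ b) ∧
        ∀ g, φ g ≤ 0 ↔ f (trunc u g) = f zero := by
  refine PMV.exists_hom_linearOrder _ (fun a b ha hb => ?_) (fun m g => hf.trunc_conj m g)
    (fun g => ?_) (fun g hg => ?_) (fun g hg => ?_)
  · refine hf.eq_zero_of_le_add ?_ ha hb
    simp only [coe_trunc]
    refine le_trans ?_ (add_inf_le_inf_add_inf u.nonneg le_sup_right le_sup_right)
    exact inf_le_inf_right _ (sup_le (add_le_add le_sup_left le_sup_left)
      (add_nonneg le_sup_right le_sup_right))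
  · refine hf.eq_zero_or_eq_zero hA (le_antisymm ?_ (le_inf (trunc u g).2.1 (trunc u (-g)).2.1))
    simp only [coe_trunc]
    refine (inf_le_inf inf_le_left inf_le_left).trans ?_
    have : (g ⊔ 0) ⊓ (-g ⊔ 0) = 0 := by
      have e : g ⊔ 0 = g + (-g ⊔ 0) := by rw [add_sup]; simp [sup_comm]
      have e' : (g ⊔ 0) ⊓ (-g ⊔ 0) = (g ⊓ 0) + (-g ⊔ 0) := by rw [e, inf_add, zero_add]
      have e2 : -g ⊔ 0 = -(g ⊓ 0) := by rw [neg_inf, neg_zero]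
      rw [e', e2, add_neg_cancel]
    exact this.le
  · have : trunc u (g ⊔ 0) = trunc u g := by ext; simp [coe_trunc]
    rwa [this]
  · congr 1
    ext
    rw [coe_trunc, sup_eq_right.2 hg, inf_eq_left.2 u.nonneg, Gamma.coe_zero]

end Hom

/-- If `Γ(G, u)` is representable, then the homomorphisms of `G` into linearly ordered groups
determine the order of `G`. -/
theorem IsRepresentable.le_of_forall_hom (hM : IsRepresentable (Gamma u)) {a b : G}
    (h : ∀ (H : Type v) [AddGroup H] [LinearOrder H] [AddLeftMono H] [AddRightMono H]
      (φ : G →+ H), (∀ x y, φ (x ⊔ y) = φ x ⊔ φ y) → φ a ≤ φ b) : a ≤ b := by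
  obtain ⟨ι, A, _, f, hlin, hhom, -, hinj⟩ := hM
  have h1 : trunc u (a - b) = zero := hinj <| funext fun i => by
    obtain ⟨H, _, _, _, _, φ, hφ, hle⟩ := (hhom i).exists_hom_linearOrder (hlin i)
    change f i _ = f i _
    rw [← hle, map_sub, sub_nonpos]
    exact h H φ hφ
  -- The vanishing truncation is `(a - b)⁺ ⊓ u`, so `(a - b)⁺` itself vanishes.
  have h2 := u.eq_zero_of_inf_eq_zero le_sup_right (congrArg Subtype.val h1)
  rw [← sub_nonpos]
  exact sup_eq_right.1 h2

theorem IsRepresentable.eq_of_forall_hom (hM : IsRepresentable (Gamma u)) {a b : G}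
    (h : ∀ (H : Type v) [AddGroup H] [LinearOrder H] [AddLeftMono H] [AddRightMono H]
      (φ : G →+ H), (∀ x y, φ (x ⊔ y) = φ x ⊔ φ y) → φ a = φ b) : a = b :=
  le_antisymm (hM.le_of_forall_hom fun H _ _ _ _ φ hφ => (h H φ hφ).le)
    (hM.le_of_forall_hom fun H _ _ _ _ φ hφ => (h H φ hφ).ge)

theorem le_of_add_self_le_add_self {H : Type*} [AddGroup H] [LinearOrder H] [AddLeftMono H]
    [AddRightMono H] {h k : H} (hk : h + h ≤ k + k) : h ≤ k :=
  le_of_not_gt fun hlt => (add_lt_add hlt hlt).not_ge hk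

theorem IsRepresentable.le_of_add_self_le (hM : IsRepresentable (Gamma u)) {h k : G}
    (hk : h + h ≤ k + k) : h ≤ k :=
  hM.le_of_forall_hom fun H _ _ _ _ φ hφ => by
    refine le_of_add_self_le_add_self ?_
    have := congrArg φ (sup_eq_right.2 hk)
    rw [hφ, sup_eq_right] at this
    simpa using this

theorem IsRepresentable.add_self_inj (hM : IsRepresentable (Gamma u)) {h k : G}
    (hk : h + h = k + k) : h = k :=
  le_antisymm (hM.le_of_add_self_le hk.le) (hM.le_of_add_self_le hk.ge)

end Chains

end PMV

namespace PMV

open PseudoMVSignature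

/-! ### Square root equations in a linearly ordered group -/

section LinearOrder

variable {H : Type*} [AddGroup H] [LinearOrder H] [AddLeftMono H] [AddRightMono H]

/-- In the linearly ordered case, the equations for a square root at an element `x` strictly
between `0` and `u`. -/
theorem eq_zero_or_eq_or_of_square_root {u c p x : H}
    (h1 : (p - u + p) ⊔ 0 = x)
    (h2 : (u - p + c - u + (u - p + c)) ⊔ 0 = u - x)
    (h3 : (c - p + u - u + (c - p + u)) ⊔ 0 = -x + u) :
    x = 0 ∨ x = u ∨ (p - u + p = x ∧ u + p = p + u ∧ c - p + c = u - p) := by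
  by_cases hx0 : x = 0
  · exact Or.inl hx0
  by_cases hxu : x = u
  · exact Or.inr (Or.inl hxu)
  have key : ∀ {a b : H}, a ⊔ 0 = b → b ≠ 0 → a = b := fun {a b} hab hb => by
    rcases le_total a 0 with h | h
    · rw [sup_eq_right.2 h] at hab
      exact absurd hab.symm hb
    · rwa [sup_eq_left.2 h] at hab
  have e1 := key h1 hx0
  have e2 := key h2 (fun h => hxu (sub_eq_zero.1 h).symm)
  have e3 := key h3 (fun h => hxu (by rwa [neg_add_eq_zero] at h))
  have e2' : c - p + c = u - p := by
    have : u - p + c - u + (u - p + c) = u - (p - u + p) + (p - u + (c - p + c)) - u + u := by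
      simp [sub_eq_add_neg, add_assoc]
    rw [this, e1, sub_add_cancel] at e2
    have e4 : p - u + (c - p + c) = 0 := by simpa using e2
    have := eq_neg_of_add_eq_zero_right e4
    simpa using this
  have e3' : c - p + c = -p + u := by
    have : c - p + u - u + (c - p + u) = (c - p + c) + (-u + p) + -(p - u + p) + u := by
      simp [sub_eq_add_neg, add_assoc]
    rw [this, e1, add_left_inj] at e3
    have e4 : (c - p + c) + (-u + p) = 0 := by simpa using e3
    have := eq_neg_of_add_eq_zero_left e4
    simpa using this
  refine Or.inr (Or.inr ⟨e1, ?_, e2'⟩)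
  have e5 := e2'.symm.trans e3'
  rw [sub_eq_iff_eq_add, add_assoc, eq_neg_add_iff_add_eq] at e5
  exact e5.symm

/-- The square root `p` of `x` in a linearly ordered group. The elements `c`, `d`, `q` are the
square roots of `0`, `c` and `p`. -/
theorem square_root_linearOrder {u c d p q x : H} (hu : 0 ≤ u) (hc : c - u + c ≤ 0) (hcp : c ≤ p)
    (hpu : p ≤ u)
    (hp : (p - u + p) ⊔ 0 = x)
    (hp2 : (u - p + c - u + (u - p + c)) ⊔ 0 = u - x)
    (hp3 : (c - p + u - u + (c - p + u)) ⊔ 0 = -x + u)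
    (hd : (d - u + d) ⊔ 0 = c)
    (hd2 : (u - d + c - u + (u - d + c)) ⊔ 0 = u - c)
    (hd3 : (c - d + u - u + (c - d + u)) ⊔ 0 = -c + u)
    (hq : (q - u + q) ⊔ 0 = p)
    (hq2 : (u - q + c - u + (u - q + c)) ⊔ 0 = u - p)
    (hq3 : (c - q + u - u + (c - q + u)) ⊔ 0 = -p + u) :
    (c = 0 ∧ p = x) ∨ (c + c = u ∧ p + p = x + u) := by
  have hc2 : c = 0 ∨ c + c = u := by
    -- The equations at `0` give only `c - u + c ≤ 0`, so those at `c`, with root `d`, are used.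
    rcases eq_zero_or_eq_or_of_square_root hd hd2 hd3 with h | h | ⟨h1, h2, h3⟩
    · exact Or.inl h
    · left
      subst h
      rw [sub_self, zero_add] at hc
      exact le_antisymm hc hu
    · right
      have hud : AddCommute u d := h2
      have e : d + d = c + u := by
        rw [← h1, add_assoc, ← hud.eq, ← add_assoc, sub_add_cancel]
      have hcd : AddCommute c d := by
        have : c = d + d - u := by rw [e, add_sub_cancel_right]
        rw [this, sub_eq_add_neg]
        exact ((AddCommute.refl d).add_left (AddCommute.refl d)).add_left hud.neg_left
      have h4 : c - d + c = c + c - d := by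
        rw [sub_eq_add_neg, add_assoc, (hcd.neg_right).symm.eq, ← add_assoc, ← sub_eq_add_neg]
      rw [h4] at h3
      exact sub_left_injective h3
  rcases hc2 with rfl | rfl
  · left
    refine ⟨rfl, ?_⟩
    -- With `c = 0` the equations at `p` force `p = 0` or `p = u`, and `(p - u + p) ⊔ 0` returns `p`
    -- in both cases.
    rcases eq_zero_or_eq_or_of_square_root hq hq2 hq3 with h | h | ⟨-, -, h⟩
    · rw [← hp, h]; simpa using hu
    · rw [← hp, h]; simpa using hu
    · have hu0 : u = 0 := by simpa using h.symm
      have hp0 : p = 0 := le_antisymm (hu0 ▸ hpu) hcp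
      rw [← hp, hp0, hu0]; simp
  · right
    refine ⟨rfl, ?_⟩
    rcases eq_zero_or_eq_or_of_square_root hp hp2 hp3 with h | h | ⟨h1, h2, -⟩
    · have h3 : p - (c + c) + p ≤ 0 := by rw [← h, ← hp]; exact le_sup_left
      have h4 : p ≤ c := by
        by_contra hlt
        rw [not_le] at hlt
        have : 0 < p - (c + c) + p := by
          have := add_pos (sub_pos.2 hlt) (lt_neg_add_iff_add_lt.2 (by rwa [add_zero]) : 0 < -c + p)
          simpa [sub_eq_add_neg, add_assoc] using this
        exact this.not_ge h3
      rw [le_antisymm h4 hcp, h, zero_add]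
    · have h4 : c + c ≤ p := by
        have hc0 : 0 ≤ c := by rw [← hd]; exact le_sup_right
        rw [← h, ← hp]
        exact sup_le (add_le_of_nonpos_left (sub_nonpos.2 hpu)) (hc0.trans hcp)
      rw [le_antisymm hpu h4, h]
    · rw [← h1, add_assoc, ← h2, ← add_assoc, sub_add_cancel]

end LinearOrder

/-! ### Identities in a group with `c + c = u` -/

section Group

variable {G : Type*} [AddGroup G] {c p u : G}

/-- Turns the untruncated root equation into a statement about halves, to which uniqueness applies
even when `u` is not central. -/
theorem sub_add_eq_iff_sub_add_sub_eq {x y : G} :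
    y - u + y = x ↔ (y - u) + (y - u) = x - u := by
  rw [← add_sub_assoc, sub_left_inj]

/-- With `c = r 0` and `p = r x`, the hypothesis is the root equation at `x⁻`; cancellation leaves
`-p + c = c + -p`. -/
theorem addCommute_of_sub_add_eq (hc : c + c = u)
    (h : u - p + c - u + (u - p + c) = u - (p - u + p)) : AddCommute c p := by
  subst hc
  have h1 : c + c - p + c + (-p + c) = c + c - p + c + (c + -p) := by
    simpa [sub_eq_add_neg, add_assoc] using h
  exact AddCommute.neg_right_iff.1 (add_left_cancel h1).symm

theorem sub_add_eq_sub_of_addCommute (h : AddCommute c p) (hc : c + c = u) :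
    u - p + c - u + (u - p + c) = u - (p - u + p) := by
  subst hc
  have h1 : c + -p = -p + c := h.neg_right
  have h2 : ∀ x, c + (-p + x) = -p + (c + x) := fun x => by rw [← add_assoc, h1, add_assoc]
  simp [sub_eq_add_neg, add_assoc, h1, h2]

theorem sub_add_eq_neg_add_of_addCommute (h : AddCommute c p) (hc : c + c = u) :
    c + (-p + u) - u + (c + (-p + u)) = -(p - u + p) + u := by
  subst hc
  have h1 : ∀ x, c + (-p + x) = -p + (c + x) := fun x => by
    rw [← add_assoc, h.neg_right.eq, add_assoc]
  simp [sub_eq_add_neg, add_assoc, h1]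

end Group

/-! ### Square roots on `Gamma u` -/

section Roots

theorem sub_add_le_of_le {G : Type*} [AddGroup G] [Lattice G] [AddLeftMono G] {a b c : G}
    (h : c ≤ b) : a - b + c ≤ a := by
  rw [sub_eq_add_neg, add_assoc]
  exact add_le_of_nonpos_right (by simpa using h)

variable {G : Type*} [AddGroup G] [Lattice G] [AddLeftMono G] [AddRightMono G] {u : StrongUnit G}

theorem IsWeakSquareRoot.apply_zero_le {r : Gamma u → Gamma u} (hr : IsWeakSquareRoot r)
    (x : Gamma u) : (r zero : G) ≤ r x := by
  rw [← Gamma.le_iff]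
  apply hr.le_of_odot_le
  rw [hr.odot_self, Gamma.le_iff]
  exact x.2.1

theorem IsStrict.add_self {r : Gamma u → Gamma u} (hs : IsStrict r) :
    (r zero : G) + r zero = u.val := by
  have := congrArg Subtype.val hs
  rw [Gamma.coe_lneg] at this
  nth_rw 1 [this]
  rw [sub_add_cancel]

theorem sub_add_nonneg_of_le {c u y : G} (hc : c + c = u) (hy : c ≤ y) : 0 ≤ y - u + y := by
  have h1 : 0 ≤ (y - c) + (-c + y) := add_nonneg (sub_nonneg.2 hy) (by
    rw [le_neg_add_iff_add_le, add_zero]; exact hy)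
  rw [← hc]
  simpa [sub_eq_add_neg, add_assoc] using h1

/-- Strictness makes the truncation at `0` idle: `y - u + y = (y - c) + (-c + y) ≥ 0` for `y ≥ c = r
0`. -/
theorem IsWeakSquareRoot.sub_add {r : Gamma u → Gamma u} (hr : IsWeakSquareRoot r)
    (hs : IsStrict r) (x : Gamma u) : (r x : G) - u.val + r x = x := by
  have := congrArg Subtype.val (hr.odot_self x)
  rwa [Gamma.coe_odot, sup_eq_left.2 (sub_add_nonneg_of_le hs.add_self (hr.apply_zero_le x))] at this

theorem IsWeakSquareRoot.range_eq (hM : IsRepresentable (Gamma u)) {r : Gamma u → Gamma u}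
    (hr : IsWeakSquareRoot r) (hs : IsStrict r) :
    Set.range (fun x => (r x : G)) = Set.Icc (r zero : G) u.val := by
  ext y
  constructor
  · rintro ⟨x, rfl⟩
    exact ⟨hr.apply_zero_le x, (r x).2.2⟩
  · rintro ⟨h1, h2⟩
    refine ⟨⟨y - u.val + y, sub_add_nonneg_of_le hs.add_self h1, ?_⟩, ?_⟩
    · exact (add_le_of_nonpos_left (sub_nonpos.2 h2)).trans h2
    · have := sub_add_eq_iff_sub_add_sub_eq.1 (hr.sub_add hs
        ⟨y - u.val + y, sub_add_nonneg_of_le hs.add_self h1,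
          (add_le_of_nonpos_left (sub_nonpos.2 h2)).trans h2⟩)
      rw [← sub_add_eq_iff_sub_add_sub_eq.1 (rfl : y - u.val + y = _)] at this
      exact sub_left_injective (hM.add_self_inj this)

theorem isTwoDivisible_iff : IsTwoDivisible (Gamma u) ↔
    ∀ x : Gamma u, ∃ y : Gamma u, (y : G) + y = x := by
  have key : ∀ x y : Gamma u, IsPartialSum y y x ↔ (y : G) + y = x := fun x y => by
    rw [IsPartialSum, Gamma.le_iff, Gamma.coe_lneg, le_sub_iff_add_le, Subtype.ext_iff,
      Gamma.coe_oplus]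
    constructor
    · rintro ⟨h1, h2⟩
      rwa [inf_eq_left.2 h1] at h2
    · intro h
      have h' : (y : G) + y ≤ u.val := by rw [h]; exact x.2.2
      exact ⟨h', by rwa [inf_eq_left.2 h']⟩
  simp only [IsTwoDivisible, key]

theorem IsWeakSquareRoot.isTwoDivisible {r : Gamma u → Gamma u}
    (hr : IsWeakSquareRoot r) (hs : IsStrict r) : IsTwoDivisible (Gamma u) := by
  rw [isTwoDivisible_iff]
  intro x
  have h := sub_add_eq_iff_sub_add_sub_eq.1 (hr.sub_add hs (rneg x))
  rw [Gamma.coe_rneg, add_sub_cancel_right] at h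
  have h' : (u.val - r (rneg x) : G) + (u.val - r (rneg x)) = x := by
    rw [← neg_sub, ← neg_add_rev, h, neg_neg]
  exact ⟨⟨u.val - r (rneg x), sub_nonneg.2 (r _).2.2, sub_le_self _ (r _).2.1⟩, h'⟩

theorem IsTwoDivisible.exists_isWeakSquareRoot (hM : IsRepresentable (Gamma u))
    (h : IsTwoDivisible (Gamma u)) :
    ∃ r : Gamma u → Gamma u, IsWeakSquareRoot r ∧ IsStrict r := by
  rw [isTwoDivisible_iff] at h
  choose s hs using h
  have key : ∀ x : Gamma u, ((lneg (s (rneg x)) : Gamma u) : G) - u.val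
      + (lneg (s (rneg x)) : Gamma u) = x := fun x => by
    rw [sub_add_eq_iff_sub_add_sub_eq, Gamma.coe_lneg]
    have h1 := hs (rneg x)
    rw [Gamma.coe_rneg] at h1
    have h2 : (u.val - s (rneg x) - u.val : G) + (u.val - s (rneg x) - u.val)
        = u.val - (s (rneg x) + s (rneg x)) - u.val := by
      simp [sub_eq_add_neg, add_assoc]
    rw [h2, h1]
    simp
  -- Halving is conjugated by negation. The order of the two negations matters: `(x∼)⁻ = u - (-x +
  -- u) = x`.
  refine ⟨fun x => lneg (s (rneg x)), ⟨fun x => ?_, fun x y hxy => ?_⟩, ?_⟩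
  · ext
    rw [Gamma.coe_odot, key, sup_eq_left.2 x.2.1]
  · rw [Gamma.le_iff, Gamma.coe_odot] at hxy
    rw [Gamma.le_iff, ← sub_le_sub_iff_right u.val]
    apply hM.le_of_add_self_le
    rw [sub_add_eq_iff_sub_add_sub_eq.1 (key x), ← add_sub_assoc, sub_le_sub_iff_right]
    exact le_sup_left.trans hxy
  · ext
    have h1 := hs (rneg zero)
    rw [Gamma.coe_rneg (zero : Gamma u), Gamma.coe_zero, neg_zero, zero_add] at h1
    have h2 : (u.val - s (rneg zero) : G) = s (rneg zero) := by
      rw [sub_eq_iff_eq_add, h1]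
    simp only [Gamma.coe_lneg, h2]

/-- The equation for a square root at `x⁻`. -/
theorem IsSquareRoot.coe_map_lneg {r : Gamma u → Gamma u} (hr : IsSquareRoot r) (x : Gamma u) :
    (r (lneg x) : G) = u.val - r x + r zero := by
  rw [hr.map_lneg, limp, Gamma.coe_oplus, Gamma.coe_lneg, inf_eq_left]
  exact sub_add_le_of_le (hr.apply_zero_le x)

/-- The equation for a square root at `x∼`. -/
theorem IsSquareRoot.coe_map_rneg {r : Gamma u → Gamma u} (hr : IsSquareRoot r) (x : Gamma u) :
    (r (rneg x) : G) = r zero - r x + u.val := by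
  rw [hr.map_rneg, rimp, Gamma.coe_oplus, Gamma.coe_rneg, ← add_assoc, ← sub_eq_add_neg,
    inf_eq_left]
  exact add_le_of_nonpos_left (sub_nonpos.2 (hr.apply_zero_le x))

theorem IsWeakSquareRoot.coe_sup {r : Gamma u → Gamma u} (hr : IsWeakSquareRoot r)
    (x : Gamma u) : ((r x : G) - u.val + r x) ⊔ 0 = x := by
  rw [← Gamma.coe_odot, hr.odot_self]

theorem IsSquareRoot.addCommute {r : Gamma u → Gamma u} (hr : IsSquareRoot r)
    (hs : IsStrict r) (x : Gamma u) : AddCommute (r zero : G) (r x) := by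
  have h1 := hr.sub_add hs x
  have h2 := hr.sub_add hs (lneg x)
  rw [hr.coe_map_lneg, Gamma.coe_lneg, ← h1] at h2
  exact addCommute_of_sub_add_eq hs.add_self h2

/-- `r 0` commutes with `u` and with each `r x`, hence with `x = r x - u + r x`; sums of elements of
`[0, u]` and `-u` exhaust `G`. -/
theorem IsSquareRoot.mem_center {r : Gamma u → Gamma u} (hr : IsSquareRoot r)
    (hs : IsStrict r) : (r zero : G) ∈ AddSubgroup.center G := by
  have hu : AddCommute (r zero : G) u.val := by
    have h := hs.add_self
    generalize (r zero : G) = c at h ⊢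
    rw [← h]
    exact (AddCommute.refl _).add_right (AddCommute.refl _)
  have key : ∀ g, AddCommute (r zero : G) g := fun g => by
    induction g using u.induction with
    | hIcc m h0 hm =>
      have h1 := hr.sub_add hs ⟨m, h0, hm⟩
      change _ = m at h1
      rw [← h1]
      rw [sub_eq_add_neg]
      exact ((hr.addCommute hs _).add_right hu.neg_right).add_right (hr.addCommute hs _)
    | hneg => exact hu.neg_right
    | hadd a b ha hb => exact ha.add_right hb
  exact AddSubgroup.mem_center_iff.2 fun g => (key g).symm

/-- When `r 0` is central, both sides of each axiom solve the same equation `y - u + y = z`, whose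
solution is unique. -/
theorem IsWeakSquareRoot.isSquareRoot (hM : IsRepresentable (Gamma u)) {r : Gamma u → Gamma u}
    (hr : IsWeakSquareRoot r) (hs : IsStrict r) (hc : (r zero : G) ∈ AddSubgroup.center G) :
    IsSquareRoot r := by
  have hcomm : ∀ g : G, AddCommute (r zero : G) g := fun g =>
    (AddSubgroup.mem_center_iff.1 hc g).symm
  have huniq : ∀ {y z : G}, y - u.val + y = z - u.val + z → y = z := fun {y z} h => by
    exact sub_left_injective (hM.add_self_inj (by rw [← add_sub_assoc, h, add_sub_assoc]))
  refine { hr with map_lneg := fun x => ?_, map_rneg := fun x => ?_ }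
  · ext
    rw [limp, Gamma.coe_oplus, Gamma.coe_lneg, inf_eq_left.2]
    · apply huniq
      rw [hr.sub_add hs, sub_add_eq_sub_of_addCommute (hcomm (r x)) hs.add_self, hr.sub_add hs,
        Gamma.coe_lneg]
    · exact sub_add_le_of_le (hr.apply_zero_le x)
  · ext
    rw [rimp, Gamma.coe_oplus, Gamma.coe_rneg, inf_eq_left.2]
    · apply huniq
      rw [hr.sub_add hs, sub_add_eq_neg_add_of_addCommute (hcomm (r x)) hs.add_self,
        hr.sub_add hs, Gamma.coe_rneg]
    · rw [← add_assoc, ← sub_eq_add_neg]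
      exact add_le_of_nonpos_left (sub_nonpos.2 (hr.apply_zero_le x))

theorem IsSquareRoot.isSymmetric {r : Gamma u → Gamma u} (hr : IsSquareRoot r)
    (hs : IsStrict r) : IsSymmetric (Gamma u) := fun x => by
  ext
  have h := AddSubgroup.mem_center_iff.1 (add_mem (hr.mem_center hs) (hr.mem_center hs)) (-(x : G))
  rw [hs.add_self] at h
  rw [Gamma.coe_rneg, Gamma.coe_lneg, h, sub_eq_add_neg]

theorem IsSquareRoot.isHalf {r : Gamma u → Gamma u} (hr : IsSquareRoot r)
    (hs : IsStrict r) (x : Gamma u) : IsHalf ((x : G) + u.val) (r x : G) := by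
  have h := AddSubgroup.mem_center_iff.1 (add_mem (hr.mem_center hs) (hr.mem_center hs)) (r x : G)
  rw [hs.add_self] at h
  rw [IsHalf, ← hr.sub_add hs x, add_assoc, h, ← add_assoc, sub_add_cancel]

theorem map_inf_of_map_sup {H : Type*} [AddGroup H] [Lattice H] [AddLeftMono H] [AddRightMono H]
    (φ : G →+ H) (hφ : ∀ x y, φ (x ⊔ y) = φ x ⊔ φ y) (x y : G) : φ (x ⊓ y) = φ x ⊓ φ y := by
  rw [← neg_neg (x ⊓ y), neg_inf, map_neg, hφ, neg_sup, map_neg, map_neg, neg_neg, neg_neg]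

/-- The image of a square root in a linearly ordered group. -/
theorem IsSquareRoot.hom_apply {H : Type*} [AddGroup H] [LinearOrder H] [AddLeftMono H]
    [AddRightMono H] {r : Gamma u → Gamma u} (hr : IsSquareRoot r)
    (φ : G →+ H) (hφ : ∀ x y, φ (x ⊔ y) = φ x ⊔ φ y) (x : Gamma u) :
    (φ (r zero) = 0 ∧ φ (r x) = φ x) ∨
      (φ (r zero) + φ (r zero) = φ u.val ∧ φ (r x) + φ (r x) = φ x + φ u.val) := by
  have hmono : ∀ {a b : G}, a ≤ b → φ a ≤ φ b := fun {a b} h => by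
    rw [← sup_eq_right, ← hφ, sup_eq_right.2 h]
  have h1 : ∀ y, (φ (r y) - φ u.val + φ (r y)) ⊔ 0 = φ y := fun y => by
    rw [← map_sub, ← map_add, ← map_zero φ, ← hφ, hr.coe_sup]
  have h2 : ∀ y, (φ u.val - φ (r y) + φ (r zero) - φ u.val + (φ u.val - φ (r y) + φ (r zero))) ⊔ 0
      = φ u.val - φ y := fun y => by
    have := h1 (lneg y)
    rwa [hr.coe_map_lneg, Gamma.coe_lneg, map_add, map_sub, map_sub] at this
  have h3 : ∀ y, (φ (r zero) - φ (r y) + φ u.val - φ u.val + (φ (r zero) - φ (r y) + φ u.val)) ⊔ 0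
      = -φ y + φ u.val := fun y => by
    have := h1 (rneg y)
    rwa [hr.coe_map_rneg, Gamma.coe_rneg, map_add, map_sub, map_add, map_neg] at this
  have h0 : φ (r zero) - φ u.val + φ (r zero) ≤ 0 := by
    have := h1 zero
    rw [Gamma.coe_zero, map_zero] at this
    exact sup_eq_right.1 this
  have hu : 0 ≤ φ u.val := by rw [← map_zero φ]; exact hmono u.nonneg
  exact square_root_linearOrder hu h0 (hmono (hr.apply_zero_le x)) (hmono (r x).2.2)
    (h1 x) (h2 x) (h3 x) (h1 (r zero)) (h2 (r zero)) (h3 (r zero)) (h1 (r x)) (h2 (r x)) (h3 (r x))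

theorem IsSquareRoot.exists_isHalf (hM : IsRepresentable (Gamma u)) {r : Gamma u → Gamma u}
    (hr : IsSquareRoot r) (x : Gamma u) {w : Gamma u} (hw : w = lneg (r zero) ⊙ₘ lneg (r zero)) :
    ∃ h : G, IsHalf ((x : G) ⊓ (lneg w : Gamma u) + (lneg w : Gamma u)) h ∧
      (r x : G) = ((x : G) ⊓ w) ⊔ h := by
  have key : ∀ {H : Type _} [AddGroup H] [LinearOrder H] [AddLeftMono H] [AddRightMono H]
      (φ : G →+ H), (∀ x y, φ (x ⊔ y) = φ x ⊔ φ y) →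
      (φ w = φ u.val ∧ φ (r x) = φ x) ∨ (φ w = 0 ∧ φ (r x) + φ (r x) = φ x + φ u.val) := by
    intro H _ _ _ _ φ hφ
    have hu : 0 ≤ φ u.val := by rw [← map_zero φ, ← sup_eq_right, ← hφ, sup_eq_right.2 u.nonneg]
    have e : φ w = (φ u.val - φ (r zero) - φ u.val + (φ u.val - φ (r zero))) ⊔ 0 := by
      rw [hw, Gamma.coe_odot, Gamma.coe_lneg, hφ, map_add, map_sub, map_sub, map_zero]
    rw [e]
    rcases hr.hom_apply φ hφ x with ⟨h1, h2⟩ | ⟨h1, h2⟩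
    · left
      refine ⟨?_, h2⟩
      rw [h1]
      simpa using hu
    · right
      refine ⟨?_, h2⟩
      rw [← h1]
      simp
  have hb : ∀ {H : Type _} [AddGroup H] [LinearOrder H] [AddLeftMono H] [AddRightMono H]
      (φ : G →+ H), (∀ x y, φ (x ⊔ y) = φ x ⊔ φ y) → ∀ y : Gamma u, 0 ≤ φ y ∧ φ y ≤ φ u.val := by
    intro H _ _ _ _ φ hφ y
    constructor
    · rw [← map_zero φ, ← sup_eq_right, ← hφ, sup_eq_right.2 y.2.1]
    · rw [← sup_eq_right, ← hφ, sup_eq_right.2 y.2.2]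
  -- The half is the part of `r x` below `w⁻`: it maps to `0` where `w` maps to `u`, and to the
  -- image of `r x` where `w` maps to `0`.
  refine ⟨(r x : G) ⊓ (lneg w : Gamma u), hM.eq_of_forall_hom fun H _ _ _ _ φ hφ => ?_,
    hM.eq_of_forall_hom fun H _ _ _ _ φ hφ => ?_⟩
  · have hbx := hb φ hφ x
    have hbr := hb φ hφ (r x)
    rw [Gamma.coe_lneg, map_add, map_add, map_inf_of_map_sup φ hφ, map_inf_of_map_sup φ hφ,
      map_sub]
    rcases key φ hφ with ⟨h1, h2⟩ | ⟨h1, h2⟩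
    · rw [h1, sub_self, inf_eq_right.2 hbx.1, inf_eq_right.2 hbr.1]
    · rw [h1, sub_zero, inf_eq_left.2 hbx.2, inf_eq_left.2 hbr.2, h2]
  · have hbx := hb φ hφ x
    have hbr := hb φ hφ (r x)
    rw [Gamma.coe_lneg, hφ, map_inf_of_map_sup φ hφ, map_inf_of_map_sup φ hφ, map_sub]
    rcases key φ hφ with ⟨h1, h2⟩ | ⟨h1, h2⟩
    · rw [h1, sub_self, inf_eq_left.2 hbx.2, inf_eq_right.2 hbr.1, sup_eq_left.2 hbx.1, h2]
    · rw [h1, sub_zero, inf_eq_right.2 hbx.1, inf_eq_left.2 hbr.2, sup_eq_right.2 hbr.1]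

end Roots

end PMV

theorem mainTheorem10 {G : Type*} [AddGroup G] [Lattice G] [AddLeftMono G] [AddRightMono G]
    (u : PMV.StrongUnit G) (hM : PMV.IsRepresentable (PMV.Gamma u)) :
    -- halves in `G` are unique, so that the notation `g/2` is meaningful
    (∀ g h k : G, PMV.IsHalf g h → PMV.IsHalf g k → h = k) ∧
    -- (1)
    (((∃ r : PMV.Gamma u → PMV.Gamma u, PMV.IsSquareRoot r ∧ PMV.IsStrict r) ↔
        PMV.IsTwoDivisible (PMV.Gamma u) ∧
          ∃ c : G, PMV.IsHalf u.val c ∧ c ∈ AddSubgroup.center G) ∧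
      (∀ r : PMV.Gamma u → PMV.Gamma u, PMV.IsSquareRoot r → PMV.IsStrict r →
        PMV.IsSymmetric (PMV.Gamma u) ∧
          ∃ c : G, PMV.IsHalf u.val c ∧
            Set.range (fun x => (r x : G)) = Set.Icc c u.val)) ∧
    -- (2)
    (((∃ r : PMV.Gamma u → PMV.Gamma u, PMV.IsWeakSquareRoot r ∧ PMV.IsStrict r) ↔
        PMV.IsTwoDivisible (PMV.Gamma u)) ∧
      (∀ r : PMV.Gamma u → PMV.Gamma u, PMV.IsWeakSquareRoot r → PMV.IsStrict r →
        ∃ c : G, PMV.IsHalf u.val c ∧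
          Set.range (fun x => (r x : G)) = Set.Icc c u.val)) ∧
    -- (3)
    ((∀ r : PMV.Gamma u → PMV.Gamma u, PMV.IsSquareRoot r → PMV.IsStrict r →
        ∀ x : PMV.Gamma u, PMV.IsHalf ((x : G) + u.val) (r x : G)) ∧
      (∀ r : PMV.Gamma u → PMV.Gamma u, PMV.IsSquareRoot r →
        ∀ w : PMV.Gamma u,
          w = PMV.odot (PMV.PseudoMVSignature.lneg (r PMV.PseudoMVSignature.zero))
            (PMV.PseudoMVSignature.lneg (r PMV.PseudoMVSignature.zero)) →
          ∀ x : PMV.Gamma u, ∃ h : G,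
            PMV.IsHalf (((x : G) ⊓ (PMV.PseudoMVSignature.lneg w : PMV.Gamma u))
              + (PMV.PseudoMVSignature.lneg w : PMV.Gamma u)) h ∧
            (r x : G) = ((x : G) ⊓ (w : G)) ⊔ h)) ∧
    -- (4)
    (PMV.IsTwoDivisible (PMV.Gamma u) →
      (∃ c : G, PMV.IsHalf u.val c ∧ c ∈ AddSubgroup.center G) →
      ∀ r : PMV.Gamma u → PMV.Gamma u, PMV.IsWeakSquareRoot r → PMV.IsStrict r →
        PMV.IsSquareRoot r) := by
  refine ⟨fun g h k hh hk => hM.add_self_inj (hh.trans hk.symm), ⟨⟨fun ⟨r, hr, hs⟩ =>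
    ⟨hr.isTwoDivisible hs, r PMV.PseudoMVSignature.zero, hs.add_self, hr.mem_center hs⟩,
    fun ⟨h2, c, hc, hcc⟩ => ?_⟩, fun r hr hs => ⟨hr.isSymmetric hs, _, hs.add_self,
      hr.range_eq hM hs⟩⟩, ⟨⟨fun ⟨r, hr, hs⟩ => hr.isTwoDivisible hs,
      fun h => h.exists_isWeakSquareRoot hM⟩, fun r hr hs => ⟨_, hs.add_self, hr.range_eq hM hs⟩⟩,
      ⟨fun r hr hs => hr.isHalf hs, fun r hr w hw x => hr.exists_isHalf hM x hw⟩,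
      fun _ ⟨c, hc, hcc⟩ r hr hs => ?_⟩
  · obtain ⟨r, hr, hs⟩ := h2.exists_isWeakSquareRoot hM
    refine ⟨r, hr.isSquareRoot hM hs ?_, hs⟩
    rwa [hM.add_self_inj (hs.add_self.trans hc.symm)]
  · refine hr.isSquareRoot hM hs ?_
    rwa [hM.add_self_inj (hs.add_self.trans hc.symm)]
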